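/- \textbf{Conventions.} A tree is a set $T\subseteq\omega^{<\omega}$ of finite sequences of natural numbers that is closed under initial segments, and $[T]=\{x\in\omega^\omega : \forall n\ x\upharpoonright n\in T\}$ is its set of infinite branches. A nonempty tree $H$ is a \emph{Hechler tree} if for every $s\in H$ we have $s^\frown n\in H$ for all but finitely many $n\in\omega$; a nonempty tree $L$ is a \emph{Laver tree} if for every $s\in L$ we have $s^\frown n\in L$ for infinitely many $n\in\omega$. A set $A\subseteq\omega^\omega$ is (boldface) $\mathbf{\Sigma}^1_2$ if it is the projection to the first coordinate of a coanalytic subset of $\omega^\omega\times\omega^\omega$. Martin's Axiom (MA) says that for every nonempty partial order (or preorder) with the countable chain condition and every family of fewer than $2^{\aleph_0}$ dense subsets of it there is a filter that meets every member of the family; CH says that $2^{\aleph_0}=\aleph_1$. \textbf{Theorem.} Assume MA and $\neg$CH. If $A\subseteq\omega^\omega$ is $\mathbf{\Sigma}^1_2$, then either there is a Hechler tree $H$ with $[H]\cap A=\emptyset$ or there is a Laver tree $L$ with $[L]\subseteq A$. More generally, the same dichotomy holds for every set $A\subseteq\omega^\omega$ that is the union of $\omega_1$ many Borel sets. -/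

import Mathlib

open Cardinal Filter MeasureTheory

/-- Two conditions of a forcing order are compatible if some condition is below both
(`p ≤ q` is read as: `p` is stronger than `q`). -/
def Compatible {P : Type} [Preorder P] (p q : P) : Prop :=
  ∃ r : P, r ≤ p ∧ r ≤ q

/-- The countable chain condition: every set of pairwise incompatible conditions is countable. -/
def CountableChainCondition (P : Type) [Preorder P] : Prop :=
  ∀ A : Set P, A.Pairwise (fun p q => ¬ Compatible p q) → A.Countable

/-- Density of a set of conditions: below every condition there is one in `D`. -/
def IsDenseInOrder {P : Type} [Preorder P] (D : Set P) : Prop :=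
  ∀ p : P, ∃ d ∈ D, d ≤ p

/-- Martin's Axiom: for every nonempty ccc (pre)order and every family of fewer than continuum
many dense sets there is a filter (nonempty, upward closed, downward directed) that meets
all of them. -/
def MartinsAxiom : Prop :=
  ∀ (P : Type) [Preorder P] [Nonempty P], CountableChainCondition P →
    ∀ 𝒟 : Set (Set P), #𝒟 < 𝔠 → (∀ D ∈ 𝒟, IsDenseInOrder D) →
      ∃ G : Order.PFilter P, ∀ D ∈ 𝒟, ∃ p ∈ D, p ∈ G

/-- The Continuum Hypothesis. -/
def ContinuumHypothesis : Prop :=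
  (𝔠 : Cardinal.{0}) = ℵ₁

/-- The set `[T]` of infinite branches of a tree `T` of finite sequences of naturals. -/
def branches (T : Descriptive.tree ℕ) : Set (ℕ → ℕ) :=
  {x | ∀ n : ℕ, (List.range n).map x ∈ T}

/-- A Hechler tree: a nonempty tree in which every node has cofinitely many children. -/
def IsHechler (H : Descriptive.tree ℕ) : Prop :=
  [] ∈ H ∧ ∀ s ∈ H, ∀ᶠ n : ℕ in cofinite, s ++ [n] ∈ H

/-- A Laver tree: a nonempty tree in which every node has infinitely many children. -/
def IsLaver (L : Descriptive.tree ℕ) : Prop :=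
  [] ∈ L ∧ ∀ s ∈ L, ∃ᶠ n : ℕ in cofinite, s ++ [n] ∈ L

/-- The dichotomy for `A`: some Hechler tree has all its branches outside `A`, or some Laver tree
has all its branches in `A`. -/
def HechlerLaverDichotomy (A : Set (ℕ → ℕ)) : Prop :=
  (∃ H : Descriptive.tree ℕ, IsHechler H ∧ branches H ∩ A = ∅) ∨
    (∃ L : Descriptive.tree ℕ, IsLaver L ∧ branches L ⊆ A)

/-- Boldface `Σ¹₂` subsets of Baire space: projections of coanalytic (boldface `Π¹₁`) subsets of
the product of Baire space with itself. -/
def IsSigma12 (A : Set (ℕ → ℕ)) : Prop :=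
  ∃ C : Set ((ℕ → ℕ) × (ℕ → ℕ)), MeasureTheory.AnalyticSet Cᶜ ∧ A = Prod.fst '' C

/-- Unions of a family of Borel subsets of Baire space indexed by a set of cardinality `ℵ₁`. -/
def IsUnionOfAlephOneBorel (A : Set (ℕ → ℕ)) : Prop :=
  ∃ (ι : Type) (B : ι → Set (ℕ → ℕ)), #ι = ℵ₁ ∧
    (∀ i, MeasurableSet[borel (ℕ → ℕ)] (B i)) ∧ A = ⋃ i, B i

/-!
A set is treated as the projection of a closed subset `C` of `(ℕ → ℕ) × (ℕ → K)`, where `K` is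
discrete and has fewer than `𝔟` elements (`SmallerThanBounding K`). Under Martin's Axiom `𝔟 = 𝔠`, by
Hechler forcing (`MartinsAxiom.smallerThanBounding`), so with `¬ CH` every `K` of cardinality `ℵ₁`
will do. Both classes of sets in the theorem are projections of this kind: a union of `ℵ₁` Borel
sets with `K = ι × ℕ` (the index of the Borel set is part of the witness), and a `Σ¹₂` set with
`K = ℕ × ω₁`, since membership in a coanalytic set amounts to a strictly decreasing map from a
countable tree to `ω₁` (`exists_isClosed_of_analyticSet_compl`).

For such a set `A`, and for a finite sequence `t` in `K`, let `A_t` be the set of points of `A` that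
have a witness extending `t`; so `A_t` is the union of the sets `A_{t⌢i}`, `i ∈ K`. Call a set null
at the node `s` if some Hechler tree with stem `s` avoids it. If the sets `A_{t⌢i}` are all null at
all nodes of a Hechler tree, then `A_t` is null, because fewer than `𝔟` Hechler trees can be
diagonalized by one, up to finitely many nodes (`HechlerNull.of_iUnion`). Hence, if `A_t` is not
null at `s`, a well-founded infinitely branching tree leads from `s` to nodes at which some
`A_{t⌢i}` is not null (`exists_hasBar_of_not_hechlerNull`). If `A` is not null at the root, these
trees are stacked to a Laver tree (`exists_isLaver_of_transitions`); along each of its branches `x`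
a witness `y` is built, and `(x, y)` is a limit of points of `C`, hence in `C`.
-/

/-! ### Initial segments of sequences -/

/-- The initial segment `x ↾ n` of a sequence, as a list of length `n`. -/
def initSeg {K : Type*} (x : ℕ → K) (n : ℕ) : List K := (List.range n).map x

@[simp] lemma length_initSeg {K : Type*} (x : ℕ → K) (n : ℕ) : (initSeg x n).length = n := by
  simp [initSeg]

@[simp] lemma initSeg_zero {K : Type*} (x : ℕ → K) : initSeg x 0 = [] := rfl

lemma initSeg_succ {K : Type*} (x : ℕ → K) (n : ℕ) : initSeg x (n + 1) = initSeg x n ++ [x n] := by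
  simp [initSeg, List.range_succ]

@[simp] lemma getElem_initSeg {K : Type*} (x : ℕ → K) (n i : ℕ) (h : i < (initSeg x n).length) :
    (initSeg x n)[i] = x i := by
  simp [initSeg]

lemma take_initSeg {K : Type*} (x : ℕ → K) {k n : ℕ} (h : k ≤ n) :
    (initSeg x n).take k = initSeg x k := by
  apply List.ext_getElem
  · simpa using h
  · intro i h1 h2
    simp

lemma initSeg_eq_iff {K : Type*} {x y : ℕ → K} {n : ℕ} :
    initSeg x n = initSeg y n ↔ ∀ i < n, x i = y i := by
  simp [initSeg]

lemma initSeg_eq_of_le {K : Type*} {x y : ℕ → K} {m n : ℕ} (h : initSeg x n = initSeg y n)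
    (hmn : m ≤ n) : initSeg x m = initSeg y m :=
  initSeg_eq_iff.2 fun i hi => initSeg_eq_iff.1 h i (hi.trans_le hmn)

lemma initSeg_injective {K : Type*} (x : ℕ → K) : Function.Injective (initSeg x) := fun m n h => by
  simpa using congrArg List.length h

/-- An increasing chain of finite sequences of unbounded length has a limit sequence. -/
lemma exists_limit_of_chain {K : Type*} (c : ℕ → List K) (hc : ∀ n, c n <+: c (n + 1))
    (hu : ∀ N, ∃ n, N < (c n).length) : ∃ y : ℕ → K, ∀ n, initSeg y (c n).length = c n := by
  have mono : ∀ m n, m ≤ n → c m <+: c n := by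
    intro m n h
    induction n, h using Nat.le_induction with
    | base => exact List.prefix_refl _
    | succ n _ ih => exact ih.trans (hc n)
  choose a ha using hu
  refine ⟨fun k => (c (a k))[k]'(ha k), fun n => ?_⟩
  apply List.ext_getElem
  · simp
  · intro i h1 h2
    simp only [getElem_initSeg]
    rcases le_total (a i) n with h | h
    · exact (mono _ _ h).getElem _
    · exact ((mono _ _ h).getElem _).symm

lemma isLocallyConstant_initSeg {K : Type*} [TopologicalSpace K] [DiscreteTopology K] (n : ℕ) :
    IsLocallyConstant fun x : ℕ → K => initSeg x n := by
  induction n with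
  | zero => exact IsLocallyConstant.const _
  | succ n ih =>
    simp only [initSeg_succ]
    exact ih.comp₂ ((IsLocallyConstant.iff_continuous _).2 (continuous_apply n))
      fun u k => u ++ [k]

lemma tendsto_of_initSeg_eq {K : Type*} [TopologicalSpace K] {x : ℕ → K} {y : ℕ → ℕ → K}
    (h : ∀ n, initSeg (y n) n = initSeg x n) : Tendsto y atTop (nhds x) := by
  rw [tendsto_pi_nhds]
  intro i
  refine tendsto_const_nhds.congr' ?_
  filter_upwards [eventually_gt_atTop i] with n hn
  exact (initSeg_eq_iff.1 (h n) i hn).symm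

/-! ### Hechler-null sets -/

/-- `HechlerNull s B`: some Hechler tree with stem `s` has no branch in `B`. The tree is encoded by
a function `f` that bounds, at each node above the stem, the children which are left out. -/
def HechlerNull (s : List ℕ) (B : Set (ℕ → ℕ)) : Prop :=
  ∃ f : List ℕ → ℕ, ∀ x ∈ B, initSeg x s.length = s → ∃ n ≥ s.length, x n < f (initSeg x n)

lemma HechlerNull.of_disjoint {s : List ℕ} {B : Set (ℕ → ℕ)}
    (h : ∀ x ∈ B, initSeg x s.length ≠ s) : HechlerNull s B :=
  ⟨0, fun x hx hs => (h x hx hs).elim⟩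

lemma HechlerNull.exists_isHechler {A : Set (ℕ → ℕ)} (h : HechlerNull [] A) :
    ∃ H : Descriptive.tree ℕ, IsHechler H ∧ branches H ∩ A = ∅ := by
  obtain ⟨f, hf⟩ := h
  let H : Descriptive.tree ℕ :=
    ⟨{s | ∀ (u : List ℕ) (m : ℕ), u ++ [m] <+: s → f u ≤ m},
      fun s a hs u m hu => hs u m (hu.trans (List.prefix_append _ _))⟩
  have hH : ∀ s, s ∈ H ↔ ∀ (u : List ℕ) (m : ℕ), u ++ [m] <+: s → f u ≤ m := fun s => Iff.rfl
  refine ⟨H, ⟨?_, ?_⟩, ?_⟩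
  · rw [hH]
    intro u m hu
    simp at hu
  · intro s hs
    rw [Nat.cofinite_eq_atTop]
    filter_upwards [eventually_ge_atTop (f s)] with n hn
    rw [hH] at hs ⊢
    intro u m hu
    rcases List.prefix_concat_iff.1 hu with h | h
    · obtain ⟨rfl, h2⟩ := List.append_inj' h rfl
      simp only [List.cons.injEq, and_true] at h2
      exact h2 ▸ hn
    · exact hs u m h
  · rw [Set.eq_empty_iff_forall_notMem]
    rintro x ⟨hx, hxA⟩
    obtain ⟨n, -, hn⟩ := hf x hxA rfl
    exact absurd ((hH _).1 (hx (n + 1)) (initSeg x n) (x n) (by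
      change _ <+: initSeg x (n + 1)
      rw [initSeg_succ])) (by omega)

lemma HechlerNull.of_children {s : List ℕ} {B : Set (ℕ → ℕ)}
    (h : ∀ᶠ m in cofinite, HechlerNull (s ++ [m]) B) : HechlerNull s B := by
  have hF : ∀ u, ∃ f : List ℕ → ℕ, HechlerNull u B →
      ∀ x ∈ B, initSeg x u.length = u → ∃ n ≥ u.length, x n < f (initSeg x n) := by
    intro u
    by_cases hu : HechlerNull u B
    · exact ⟨hu.choose, fun _ => hu.choose_spec⟩
    · exact ⟨0, fun h => (hu h).elim⟩
  choose F hF using hF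
  rw [Nat.cofinite_eq_atTop, eventually_atTop] at h
  obtain ⟨N, hN⟩ := h
  refine ⟨fun u => max N (F (u.take (s.length + 1)) u), fun x hx hs => ?_⟩
  by_cases hxN : x s.length < N
  · exact ⟨s.length, le_rfl, lt_max_of_lt_left hxN⟩
  · have hu : initSeg x (s.length + 1) = s ++ [x s.length] := by rw [initSeg_succ, hs]
    obtain ⟨n, hn, hlt⟩ := hF _ (hN _ (not_lt.1 hxN)) x hx (by simpa using hu)
    have hn' : s.length + 1 ≤ n := by simpa using hn
    refine ⟨n, by omega, lt_max_of_lt_right ?_⟩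
    rwa [take_initSeg x hn', hu]

/-- Every `K`-indexed family of functions from finite sequences to `ℕ` is dominated, modulo finite
sets, by a single function; in other words, `#K` is less than the bounding number. -/
def SmallerThanBounding (K : Type) : Prop :=
  ∀ F : K → List ℕ → ℕ, ∃ g : List ℕ → ℕ, ∀ i, {u | g u < F i u}.Finite

/-- Null sets are closed under `K`-indexed unions, provided that the members are null
at all nodes of a Hechler tree `P`. A branch that obeys the dominating function eventually obeys the
`i`-th function as well, although perhaps not from the stem on; this is why the members have to be
null at later nodes also. -/
lemma HechlerNull.of_iUnion {K : Type} (hK : SmallerThanBounding K) {P : Set (List ℕ)}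
    (hP : ∀ u ∈ P, ∀ᶠ m in cofinite, u ++ [m] ∈ P) {s : List ℕ} (hs : s ∈ P)
    {B : Set (ℕ → ℕ)} {B' : K → Set (ℕ → ℕ)} (hB : B ⊆ ⋃ i, B' i)
    (hnull : ∀ u ∈ P, ∀ i, HechlerNull u (B' i)) : HechlerNull s B := by
  have hF : ∀ u i, ∃ f : List ℕ → ℕ, u ∈ P →
      ∀ x ∈ B' i, initSeg x u.length = u → ∃ n ≥ u.length, x n < f (initSeg x n) := by
    intro u i
    by_cases hu : u ∈ P
    · exact ⟨(hnull u hu i).choose, fun _ => (hnull u hu i).choose_spec⟩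
    · exact ⟨0, fun h => (hu h).elim⟩
  choose F hF using hF
  have hN : ∀ u, ∃ N, u ∈ P → ∀ m ≥ N, u ++ [m] ∈ P := by
    intro u
    by_cases hu : u ∈ P
    · have := hP u hu
      rw [Nat.cofinite_eq_atTop, eventually_atTop] at this
      exact this.imp fun N h _ => h
    · exact ⟨0, fun h => (hu h).elim⟩
  choose N hN using hN
  obtain ⟨g, hg⟩ := hK fun i u => (Finset.range (u.length + 1)).sup fun k => F (u.take k) i u
  refine ⟨fun u => max (N u) (g u), fun x hx hxs => ?_⟩
  by_contra! hcon
  have hmem : ∀ n ≥ s.length, initSeg x n ∈ P := by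
    intro n hn
    induction n, hn using Nat.le_induction with
    | base => rwa [hxs]
    | succ n hn ih =>
      rw [initSeg_succ]
      exact hN _ ih _ ((le_max_left _ _).trans (hcon n hn))
  obtain ⟨i, hi⟩ := Set.mem_iUnion.1 (hB hx)
  obtain ⟨k, hk⟩ := ((hg i).preimage (initSeg_injective x).injOn).bddAbove
  obtain ⟨n, hn, hlt⟩ := hF (initSeg x (max (k + 1) s.length)) i
    (hmem _ (le_max_right _ _)) x hi (by simp)
  rw [length_initSeg] at hn
  have h1 : ¬ n ∈ initSeg x ⁻¹' {u | g u < (Finset.range (u.length + 1)).sup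
      fun k => F (u.take k) i u} := fun h => by
    have := hk h
    omega
  have h2 : F (initSeg x (max (k + 1) s.length)) i (initSeg x n) ≤
      (Finset.range ((initSeg x n).length + 1)).sup
        fun k => F ((initSeg x n).take k) i (initSeg x n) := by
    have := Finset.le_sup (s := Finset.range ((initSeg x n).length + 1))
      (f := fun k => F ((initSeg x n).take k) i (initSeg x n))
      (b := max (k + 1) s.length) (by simp only [Finset.mem_range, length_initSeg]; omega)
    simpa only [take_initSeg x hn] using this
  have h3 := hcon n (by omega)
  have h4 : g (initSeg x n) ≤ x n := (le_max_right _ _).trans h3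
  simp only [Set.mem_preimage, Set.mem_ofPred_eq, not_lt] at h1
  omega

/-! ### Bars of ordinal rank -/

/-- `HasBar S α s`: there is a tree with stem `s` of rank at most `α`, infinitely branching at its
non-terminal nodes, whose terminal nodes all lie in `S`. -/
inductive HasBar (S : Set (List ℕ)) : Ordinal.{0} → List ℕ → Prop
  | hit {α : Ordinal.{0}} {s : List ℕ} (hs : s ∈ S) : HasBar S α s
  | step {α : Ordinal.{0}} {s : List ℕ} (β : ℕ → Ordinal.{0}) (I : Set ℕ) (hI : I.Infinite)
      (hβ : ∀ m ∈ I, β m < α) (h : ∀ m ∈ I, HasBar S (β m) (s ++ [m])) : HasBar S α s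

lemma HasBar.exists_mem {S : Set (List ℕ)} {α : Ordinal.{0}} {s : List ℕ} (h : HasBar S α s) :
    ∃ u ∈ S, s <+: u := by
  induction h with
  | hit hs => exact ⟨_, hs, List.prefix_refl _⟩
  | step β I hI hβ h ih =>
    obtain ⟨m, hm⟩ := hI.nonempty
    obtain ⟨u, hu, hsu⟩ := ih m hm
    exact ⟨u, hu, (List.prefix_append _ _).trans hsu⟩

lemma eventually_not_hasBar {S : Set (List ℕ)} {s : List ℕ} (h : ∀ α, ¬ HasBar S α s) :
    ∀ᶠ m in cofinite, ∀ α, ¬ HasBar S α (s ++ [m]) := by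
  by_contra hcon
  have hinf : {m | ∃ α, HasBar S α (s ++ [m])}.Infinite := by
    intro hfin
    apply hcon
    rw [eventually_cofinite]
    refine hfin.subset fun m hm => ?_
    simpa using hm
  have hβ : ∀ m, ∃ α, m ∈ {m | ∃ α, HasBar S α (s ++ [m])} → HasBar S α (s ++ [m]) := by
    intro m
    by_cases hm : ∃ α, HasBar S α (s ++ [m])
    · exact hm.imp fun α h _ => h
    · exact ⟨0, fun h => (hm h).elim⟩
  choose β hβ using hβ
  refine h (Order.succ (⨆ m, β m)) (HasBar.step β _ hinf (fun m _ => ?_) hβ)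
  exact Order.lt_succ_iff.2 (Ordinal.le_iSup β m)

/-- If `B` is not null at `s`, and `B` is the union of the sets `B' i`, then there is a bar above
`s` consisting of nodes at which some `B' i` is not null. Otherwise the nodes without a bar form a
Hechler tree at all of whose nodes every `B' i` is null. -/
lemma exists_hasBar_of_not_hechlerNull {K : Type} (hK : SmallerThanBounding K) {s : List ℕ}
    {B : Set (ℕ → ℕ)} {B' : K → Set (ℕ → ℕ)} (hB : B ⊆ ⋃ i, B' i) (hs : ¬ HechlerNull s B) :
    ∃ α, HasBar {u | ∃ i, ¬ HechlerNull u (B' i)} α s := by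
  by_contra! hcon
  refine hs (HechlerNull.of_iUnion hK (P := {u | ∀ α, ¬ HasBar _ α u})
    (fun u hu => eventually_not_hasBar hu) hcon hB fun u hu i => ?_)
  by_contra hi
  exact hu 0 (HasBar.hit ⟨i, hi⟩)

/-! ### Laver trees from transition systems -/

/-- Unfolding a transition system in which every state has successors at infinitely many children
of its node yields a Laver tree whose branches are traced by infinite runs. -/
lemma exists_isLaver_of_transitions {Q : Type*} (node : Q → List ℕ) (R : Q → Q → Prop)
    (hR : ∀ q, ∃ᶠ m in cofinite, ∃ q', R q q' ∧ node q' = node q ++ [m])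
    (q₀ : Q) (hq₀ : node q₀ = []) :
    ∃ L : Descriptive.tree ℕ, IsLaver L ∧ ∀ x ∈ branches L, ∃ σ : ℕ → Q,
      (∀ n, node (σ n) = initSeg x n) ∧ ∀ n, R (σ n) (σ (n + 1)) := by
  have hnext : ∀ q m, ∃ o : Option Q, (∀ q' ∈ o, R q q' ∧ node q' = node q ++ [m]) ∧
      ((∃ q', R q q' ∧ node q' = node q ++ [m]) → o.isSome) := by
    intro q m
    by_cases h : ∃ q', R q q' ∧ node q' = node q ++ [m]
    · obtain ⟨q', h'⟩ := h
      exact ⟨some q', by simpa using h', fun _ => rfl⟩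
    · exact ⟨none, by simp, fun h' => (h h').elim⟩
  choose next hnext hsome using hnext
  let run : List ℕ → Option Q := fun u => u.foldl (fun o m => o.bind (next · m)) (some q₀)
  have run_nil : run [] = some q₀ := rfl
  have run_append : ∀ u m, run (u ++ [m]) = (run u).bind (next · m) := by
    intro u m
    simp [run]
  have node_run : ∀ u, ∀ q ∈ run u, node q = u := by
    intro u
    induction u using List.reverseRecOn with
    | nil =>
      intro q hq
      simp only [run_nil, Option.mem_def, Option.some.injEq] at hq
      rw [← hq, hq₀]
    | append_singleton u m ih =>
      intro q hq
      rw [run_append, Option.mem_def, Option.bind_eq_some_iff] at hq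
      obtain ⟨p, hp, hpq⟩ := hq
      rw [(hnext p m q hpq).2, ih p hp]
  let L : Descriptive.tree ℕ := ⟨{u | (run u).isSome}, fun u m h => by
    simp only [Set.mem_ofPred_eq, run_append, Option.isSome_iff_exists,
      Option.bind_eq_some_iff] at h ⊢
    obtain ⟨_, p, hp, -⟩ := h
    exact ⟨p, hp⟩⟩
  have hL : ∀ u, u ∈ L ↔ (run u).isSome := fun u => Iff.rfl
  refine ⟨L, ⟨by rw [hL, run_nil]; rfl, fun u hu => ?_⟩, fun x hx => ?_⟩
  · obtain ⟨q, hq⟩ := Option.isSome_iff_exists.1 ((hL u).1 hu)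
    refine (hR q).mono fun m hm => ?_
    rw [hL, run_append, hq]
    exact hsome q m hm
  · have hx' : ∀ n, ∃ q, run (initSeg x n) = some q := fun n =>
      Option.isSome_iff_exists.1 ((hL _).1 (hx n))
    choose σ hσ using hx'
    refine ⟨σ, fun n => node_run _ _ (hσ n), fun n => ?_⟩
    have h := hσ (n + 1)
    rw [initSeg_succ, run_append, hσ n, Option.bind_some] at h
    exact (hnext _ _ _ h).1

/-! ### The dichotomy for Suslin sets -/

/-- `A` is `K`-Suslin: the projection of a closed subset of `(ℕ → ℕ) × (ℕ → K)`; the topology on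
`K` is meant to be discrete. -/
def IsSuslin (K : Type) [TopologicalSpace K] (A : Set (ℕ → ℕ)) : Prop :=
  ∃ C : Set ((ℕ → ℕ) × (ℕ → K)), IsClosed C ∧ A = Prod.fst '' C

/-- The points of the projection of `C` with a witness that extends `t`. -/
def projAbove {K : Type} (C : Set ((ℕ → ℕ) × (ℕ → K))) (t : List K) : Set (ℕ → ℕ) :=
  {x | ∃ y, (x, y) ∈ C ∧ initSeg y t.length = t}

lemma projAbove_subset_iUnion {K : Type} (C : Set ((ℕ → ℕ) × (ℕ → K))) (t : List K) :
    projAbove C t ⊆ ⋃ i, projAbove C (t ++ [i]) := by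
  rintro x ⟨y, hy, hyt⟩
  refine Set.mem_iUnion.2 ⟨y t.length, y, hy, ?_⟩
  rw [List.length_append, List.length_singleton, initSeg_succ, hyt]

lemma HechlerNull.frequently_not {s : List ℕ} {B : Set (ℕ → ℕ)} (h : ¬ HechlerNull s B) :
    ∃ᶠ m in cofinite, ¬ HechlerNull (s ++ [m]) B := fun hcon =>
  h (.of_children (hcon.mono fun _ hm => not_not.1 hm))

/-- A state carries a node, a finite part (`label`) of the witness to be built, and the rank of a
bar above the node, made up of nodes at which some `projAbove C (label ++ [i])` is not null. -/
structure SuslinState {K : Type} (C : Set ((ℕ → ℕ) × (ℕ → K))) where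
  node : List ℕ
  label : List K
  rank : Ordinal.{0}
  hasBar : HasBar {u | ∃ i, ¬ HechlerNull u (projAbove C (label ++ [i]))} rank node

/-- A transition either keeps the finite part of the witness and lowers the rank, or it lengthens
the finite part of the witness. -/
def SuslinState.Step {K : Type} {C : Set ((ℕ → ℕ) × (ℕ → K))} (q q' : SuslinState C) : Prop :=
  (q'.label = q.label ∧ q'.rank < q.rank) ∨ ∃ i, q'.label = q.label ++ [i]

lemma SuslinState.frequently_step {K : Type} (hK : SmallerThanBounding K)
    {C : Set ((ℕ → ℕ) × (ℕ → K))} (q : SuslinState C) :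
    ∃ᶠ m in cofinite, ∃ q', q.Step q' ∧ q'.node = q.node ++ [m] := by
  obtain ⟨s, t, α, hq⟩ := q
  cases hq with
  | hit hs =>
    obtain ⟨i, hi⟩ := hs
    refine (HechlerNull.frequently_not hi).mono fun m hm => ?_
    obtain ⟨β, hβ⟩ := exists_hasBar_of_not_hechlerNull hK (projAbove_subset_iUnion C _) hm
    exact ⟨⟨s ++ [m], t ++ [i], β, hβ⟩, Or.inr ⟨i, rfl⟩, rfl⟩
  | step β I hI hβ h =>
    refine (frequently_cofinite_iff_infinite.2 hI).mono fun m hm => ?_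
    exact ⟨⟨s ++ [m], t, β m, h m hm⟩, Or.inl ⟨rfl, hβ m hm⟩, rfl⟩

/-- The ranks cannot decrease forever, so the finite part of the witness grows along a run. -/
lemma SuslinState.exists_length_lt {K : Type} {C : Set ((ℕ → ℕ) × (ℕ → K))}
    {σ : ℕ → SuslinState C} (hσ : ∀ n, (σ n).Step (σ (n + 1))) (n : ℕ) :
    ∃ m ≥ n, (σ n).label.length < (σ m).label.length := by
  induction h : (σ n).rank using WellFoundedLT.induction generalizing n with
  | ind α ih =>
    rcases hσ n with ⟨h1, h2⟩ | ⟨i, hi⟩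
    · obtain ⟨m, hm, hlt⟩ := ih _ (h ▸ h2) (n + 1) rfl
      exact ⟨m, by omega, h1 ▸ hlt⟩
    · exact ⟨n + 1, by omega, by simp [hi]⟩

lemma SuslinState.mem_of_run {K : Type} [TopologicalSpace K] {C : Set ((ℕ → ℕ) × (ℕ → K))}
    (hC : IsClosed C) {σ : ℕ → SuslinState C} (hσ : ∀ n, (σ n).Step (σ (n + 1))) {x : ℕ → ℕ}
    (hx : ∀ n, (σ n).node = initSeg x n) : x ∈ Prod.fst '' C := by
  have hpre : ∀ n, (σ n).label <+: (σ (n + 1)).label := by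
    intro n
    rcases hσ n with ⟨h, -⟩ | ⟨i, h⟩
    · rw [h]
    · rw [h]
      exact List.prefix_append _ _
  have hlen : ∀ N, ∃ n ≥ N, N < (σ n).label.length := by
    intro N
    induction N with
    | zero =>
      obtain ⟨m, hm, h⟩ := exists_length_lt hσ 0
      exact ⟨m, hm, by omega⟩
    | succ N ih =>
      obtain ⟨n, hn, h⟩ := ih
      obtain ⟨m, hm, h'⟩ := exists_length_lt hσ n
      have hle : m ≠ n := by
        rintro rfl
        exact lt_irrefl _ h'
      exact ⟨m, by omega, by omega⟩
  obtain ⟨y, hy⟩ := exists_limit_of_chain (fun n => (σ n).label) hpre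
    fun N => (hlen N).imp fun n h => h.2
  have happrox : ∀ N, ∃ p ∈ C, initSeg p.1 N = initSeg x N ∧ initSeg p.2 N = initSeg y N := by
    intro N
    obtain ⟨n, hn, hN⟩ := hlen N
    obtain ⟨u, ⟨i, hi⟩, hu⟩ := (σ n).hasBar.exists_mem
    have : ∃ x' ∈ projAbove C ((σ n).label ++ [i]), initSeg x' u.length = u := by
      by_contra! hcon
      exact hi (.of_disjoint hcon)
    obtain ⟨x', ⟨y', hC', hy'⟩, hx'⟩ := this
    refine ⟨(x', y'), hC', ?_, ?_⟩
    · rw [hx n] at hu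
      have hle : n ≤ u.length := by simpa using hu.length_le
      have h1 : initSeg x' n = initSeg x n := by
        rw [← take_initSeg x' hle, hx']
        simpa using (List.prefix_iff_eq_take.1 hu).symm
      exact initSeg_eq_of_le h1 hn
    · have h1 : initSeg y' (σ n).label.length = initSeg y (σ n).label.length := by
        rw [hy n, ← take_initSeg y' (by simp : _ ≤ ((σ n).label ++ [i]).length), hy']
        simp
      exact initSeg_eq_of_le h1 hN.le
  choose p hpC hp1 hp2 using happrox
  refine ⟨(x, y), hC.mem_of_tendsto (f := p) (b := atTop) ?_ (.of_forall hpC), rfl⟩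
  exact (tendsto_of_initSeg_eq hp1).prodMk_nhds (tendsto_of_initSeg_eq hp2)

theorem IsSuslin.hechlerLaverDichotomy {K : Type} [TopologicalSpace K]
    (hK : SmallerThanBounding K) {A : Set (ℕ → ℕ)} (hA : IsSuslin K A) :
    HechlerLaverDichotomy A := by
  obtain ⟨C, hC, rfl⟩ := hA
  by_cases h : HechlerNull [] (Prod.fst '' C)
  · exact Or.inl h.exists_isHechler
  right
  have h0 : projAbove C [] = Prod.fst '' C := by
    ext x
    simp [projAbove]
  rw [← h0] at h
  obtain ⟨α, hα⟩ := exists_hasBar_of_not_hechlerNull hK (projAbove_subset_iUnion C _) h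
  obtain ⟨L, hL, hrun⟩ := exists_isLaver_of_transitions (fun q : SuslinState C => q.node)
    SuslinState.Step (SuslinState.frequently_step hK) ⟨[], [], α, hα⟩ rfl
  refine ⟨L, hL, fun x hx => ?_⟩
  obtain ⟨σ, hσ, hstep⟩ := hrun x hx
  exact SuslinState.mem_of_run hC hstep hσ

/-! ### Hechler forcing -/

/-- Hechler forcing for a family `F : K → ℕ → ℕ`: a condition is a finite initial segment of the
dominating function together with a finite set of indices whose functions have to be respected by
all values that are added later. -/
structure HechlerForcing {K : Type} (F : K → ℕ → ℕ) where
  stem : List ℕ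
  side : Finset K

instance {K : Type} (F : K → ℕ → ℕ) : Preorder (HechlerForcing F) where
  le p q := q.stem <+: p.stem ∧ q.side ⊆ p.side ∧
    ∀ (n : ℕ) (h : n < p.stem.length), q.stem.length ≤ n → ∀ i ∈ q.side, F i n ≤ p.stem[n]
  le_refl p := ⟨List.prefix_refl _, subset_rfl, fun n h h' => by omega⟩
  le_trans p q r hpq hqr := by
    refine ⟨hqr.1.trans hpq.1, hqr.2.1.trans hpq.2.1, fun n h hn i hi => ?_⟩
    by_cases hq : n < q.stem.length
    · rw [← hpq.1.getElem hq]
      exact hqr.2.2 n hq hn i hi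
    · exact hpq.2.2 n h (not_lt.1 hq) i (hqr.2.1 hi)

lemma HechlerForcing.le_iff {K : Type} {F : K → ℕ → ℕ} {p q : HechlerForcing F} :
    p ≤ q ↔ q.stem <+: p.stem ∧ q.side ⊆ p.side ∧
      ∀ (n : ℕ) (h : n < p.stem.length), q.stem.length ≤ n → ∀ i ∈ q.side, F i n ≤ p.stem[n] :=
  Iff.rfl

/-- Conditions with the same finite part are compatible, and there are only countably many
finite parts. -/
lemma HechlerForcing.countableChainCondition {K : Type} (F : K → ℕ → ℕ) :
    CountableChainCondition (HechlerForcing F) := by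
  classical
  intro A hA
  have hinj : Set.InjOn (fun p : HechlerForcing F => p.stem) A := by
    intro p hp q hq hpq
    by_contra hne
    refine hA hp hq hne ⟨⟨p.stem, p.side ∪ q.side⟩, ?_, ?_⟩
    · exact le_iff.2 ⟨List.prefix_refl _, Finset.subset_union_left, fun n h h' => by
        simp only at h; omega⟩
    · refine le_iff.2 ⟨?_, Finset.subset_union_right, fun n h h' => ?_⟩
      · simp only at hpq
        simp [hpq]
      · simp only at h hpq
        rw [hpq] at h
        omega
  exact Set.countable_of_injective_of_countable_image hinj (Set.to_countable _)

lemma HechlerForcing.isDenseInOrder_length {K : Type} (F : K → ℕ → ℕ) (n : ℕ) :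
    IsDenseInOrder {p : HechlerForcing F | n < p.stem.length} := by
  intro p
  refine ⟨⟨p.stem ++ List.ofFn fun k : Fin (n + 1) => p.side.sup fun i =>
    F i (p.stem.length + k), p.side⟩,
    ?_, le_iff.2 ⟨List.prefix_append _ _, subset_rfl, fun m hm h i hi => ?_⟩⟩
  · change n < (p.stem ++ _).length
    simp only [List.length_append, List.length_ofFn]
    omega
  · simp only [List.getElem_append_right h, List.getElem_ofFn, Nat.add_sub_cancel' h]
    exact Finset.le_sup (f := fun i => F i m) hi

lemma HechlerForcing.isDenseInOrder_mem {K : Type} (F : K → ℕ → ℕ) (i : K) :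
    IsDenseInOrder {p : HechlerForcing F | i ∈ p.side} := by
  classical
  intro p
  refine ⟨⟨p.stem, insert i p.side⟩, Finset.mem_insert_self _ _,
    le_iff.2 ⟨List.prefix_refl _, Finset.subset_insert _ _, fun n h h' => ?_⟩⟩
  simp only at h
  omega

lemma HechlerForcing.exists_dominating {K : Type} (F : K → ℕ → ℕ)
    (G : Order.PFilter (HechlerForcing F)) (hlen : ∀ n, ∃ p ∈ G, n < p.stem.length)
    (hmem : ∀ i, ∃ p ∈ G, i ∈ p.side) : ∃ g : ℕ → ℕ, ∀ i, ∃ N, ∀ n ≥ N, F i n ≤ g n := by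
  choose p hpG hp using hlen
  refine ⟨fun n => (p n).stem[n]'(hp n), fun i => ?_⟩
  obtain ⟨q, hqG, hq⟩ := hmem i
  refine ⟨q.stem.length, fun n hn => ?_⟩
  obtain ⟨r, -, hrp, hrq⟩ := G.directed (p n) (hpG n) q hqG
  have hr : n < r.stem.length := (hp n).trans_le (le_iff.1 hrp).1.length_le
  change F i n ≤ (p n).stem[n]'(hp n)
  rw [(le_iff.1 hrp).1.getElem (hp n)]
  exact (le_iff.1 hrq).2.2 n hr hn i hq

/-- Under Martin's Axiom the bounding number is at least the continuum. -/
lemma MartinsAxiom.smallerThanBounding (hMA : MartinsAxiom) {K : Type} (hK : #K < 𝔠) :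
    SmallerThanBounding K := by
  intro F
  let F' : K → ℕ → ℕ := fun i n => F i (Denumerable.ofNat (List ℕ) n)
  have : Nonempty (HechlerForcing F') := ⟨⟨[], ∅⟩⟩
  obtain ⟨G, hG⟩ := hMA (HechlerForcing F') (HechlerForcing.countableChainCondition F')
    (Set.range (fun n => {p : HechlerForcing F' | n < p.stem.length}) ∪
      Set.range fun i => {p : HechlerForcing F' | i ∈ p.side})
    (by
      refine (mk_union_le _ _).trans_lt (add_lt_of_lt aleph0_le_continuum ?_ ?_)
      · exact mk_range_le.trans_lt (by simpa using aleph0_lt_continuum)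
      · exact mk_range_le.trans_lt hK)
    (by
      rintro _ (⟨n, rfl⟩ | ⟨i, rfl⟩)
      · exact HechlerForcing.isDenseInOrder_length F' n
      · exact HechlerForcing.isDenseInOrder_mem F' i)
  obtain ⟨g, hg⟩ := HechlerForcing.exists_dominating F' G
    (fun n => (hG _ (Or.inl ⟨n, rfl⟩)).imp fun p h => h.symm)
    (fun i => (hG _ (Or.inr ⟨i, rfl⟩)).imp fun p h => h.symm)
  refine ⟨fun u => g (Encodable.encode u), fun i => ?_⟩
  obtain ⟨N, hN⟩ := hg i
  refine ((Set.finite_lt_nat N).preimage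
    (Encodable.encode_injective (α := List ℕ)).injOn).subset fun u hu => ?_
  by_contra hcon
  have h := hN (Encodable.encode u) (not_lt.1 hcon)
  simp only [F', Denumerable.ofNat_encode] at h
  exact absurd h (not_le.2 hu)

/-! ### Suslin representations -/

lemma isSuslin_iUnion_of_analyticSet {ι : Type} [TopologicalSpace ι] [DiscreteTopology ι]
    {B : ι → Set (ℕ → ℕ)} (hB : ∀ i, AnalyticSet (B i)) :
    IsSuslin (ι × ℕ) (⋃ i, B i) := by
  have hφ : ∀ i, ∃ φ : (ℕ → ℕ) → (ℕ → ℕ), Continuous φ ∧ (B i ≠ ∅ → Set.range φ = B i) := by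
    intro i
    have h := hB i
    rw [AnalyticSet] at h
    rcases h with h | ⟨φ, hφ, hr⟩
    · exact ⟨id, continuous_id, fun h' => (h' h).elim⟩
    · exact ⟨φ, hφ, fun _ => hr⟩
  choose φ hφ hr using hφ
  -- The first coordinate of `y 0` names a member of the union, the second coordinates of `y` form
  -- a point that the corresponding parametrization maps to `x`.
  refine ⟨{p | B (p.2 0).1 ≠ ∅} ∩ {p | φ (p.2 0).1 (fun n => (p.2 n).2) = p.1}, ?_, ?_⟩
  · have hc : Continuous fun p : (ℕ → ℕ) × (ℕ → ι × ℕ) => (p.2 0).1 := by fun_prop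
    refine ((isClosed_discrete {i | B i ≠ ∅}).preimage hc).inter (isClosed_eq ?_ continuous_fst)
    have h : Continuous fun q : ι × (ℕ → ℕ) => φ q.1 q.2 :=
      continuous_prod_of_discrete_left.2 hφ
    exact h.comp (hc.prodMk (by fun_prop))
  · ext x
    simp only [Set.mem_iUnion, Set.mem_image, Prod.exists, exists_and_right, exists_eq_right]
    constructor
    · rintro ⟨i, hi⟩
      have hne : B i ≠ ∅ := Set.nonempty_iff_ne_empty.1 ⟨x, hi⟩
      rw [← hr i hne] at hi
      obtain ⟨w, hw⟩ := hi
      exact ⟨fun n => (i, w n), hne, hw⟩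
    · rintro ⟨y, hne, hy⟩
      refine ⟨(y 0).1, ?_⟩
      rw [← hr _ hne]
      exact ⟨_, hy⟩

open scoped Ordinal in
/-- A well-order of type `ω₁`: it has `ℵ₁` elements, and its countable subsets are bounded. -/
lemma exists_wellOrder_omega_one : ∃ (W : Type) (_ : LinearOrder W), WellFoundedLT W ∧ #W = ℵ₁ ∧
    ∀ S : Set W, S.Countable → ∃ b, ∀ a ∈ S, a < b := by
  refine ⟨(ω₁ : Ordinal.{0}).ToType, inferInstance, inferInstance, by simp, fun S hS => ?_⟩
  have hS' : ¬ IsCofinal S := fun h => by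
    have h1 := Order.cof_le h
    rw [Ordinal.cof_toType, cof_omega_one] at h1
    exact absurd (h1.trans (le_aleph0_iff_set_countable.2 hS)) (not_le.2 aleph0_lt_aleph_one)
  simpa [IsCofinal] using hS'

/-- The tree of attempts to find `w` with `φ w = p`: its nodes are the initial segments `s` that can
be extended to a point whose image agrees with `p` up to the length of `s`. -/
def preimageTree (φ : (ℕ → ℕ) → (ℕ → ℕ) × (ℕ → ℕ)) (p : (ℕ → ℕ) × (ℕ → ℕ)) : Set (List ℕ) :=
  {s | ∃ w, initSeg w s.length = s ∧ initSeg (φ w).1 s.length = initSeg p.1 s.length ∧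
    initSeg (φ w).2 s.length = initSeg p.2 s.length}

lemma preimageTree_of_append {φ : (ℕ → ℕ) → (ℕ → ℕ) × (ℕ → ℕ)} {p : (ℕ → ℕ) × (ℕ → ℕ)}
    {s t : List ℕ} (h : s ++ t ∈ preimageTree φ p) : s ∈ preimageTree φ p := by
  obtain ⟨w, h1, h2, h3⟩ := h
  have hle : s.length ≤ (s ++ t).length := by simp
  refine ⟨w, ?_, initSeg_eq_of_le h2 hle, initSeg_eq_of_le h3 hle⟩
  rw [← take_initSeg w hle, h1]
  simp

lemma isClopen_preimageTree (φ : (ℕ → ℕ) → (ℕ → ℕ) × (ℕ → ℕ)) (s : List ℕ) :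
    IsClopen {p | s ∈ preimageTree φ p} := by
  have h : IsLocallyConstant fun p : (ℕ → ℕ) × (ℕ → ℕ) =>
      (initSeg p.1 s.length, initSeg p.2 s.length) :=
    ((isLocallyConstant_initSeg _).comp_continuous continuous_fst).prodMk
      ((isLocallyConstant_initSeg _).comp_continuous continuous_snd)
  have hs : {p | s ∈ preimageTree φ p} = (fun p : (ℕ → ℕ) × (ℕ → ℕ) =>
      (initSeg p.1 s.length, initSeg p.2 s.length)) ⁻¹' {q | ∃ w, initSeg w s.length = s ∧
        initSeg (φ w).1 s.length = q.1 ∧ initSeg (φ w).2 s.length = q.2} := rfl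
  rw [hs]
  exact ⟨⟨h {q | ∃ w, initSeg w s.length = s ∧
    initSeg (φ w).1 s.length = q.1 ∧ initSeg (φ w).2 s.length = q.2}ᶜ⟩, h _⟩

lemma eq_of_forall_mem_preimageTree {φ : (ℕ → ℕ) → (ℕ → ℕ) × (ℕ → ℕ)} (hφ : Continuous φ)
    {p : (ℕ → ℕ) × (ℕ → ℕ)} {w : ℕ → ℕ} (h : ∀ n, initSeg w n ∈ preimageTree φ p) : φ w = p := by
  choose v h1 h2 h3 using h
  simp only [length_initSeg] at h1 h2 h3
  exact tendsto_nhds_unique ((hφ.tendsto w).comp (tendsto_of_initSeg_eq h1))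
    ((tendsto_of_initSeg_eq h2).prodMk_nhds (tendsto_of_initSeg_eq h3))

lemma wellFounded_preimageTree {φ : (ℕ → ℕ) → (ℕ → ℕ) × (ℕ → ℕ)} (hφ : Continuous φ)
    {p : (ℕ → ℕ) × (ℕ → ℕ)} (hp : p ∉ Set.range φ) :
    WellFounded fun t s : List ℕ => ∃ m, t = s ++ [m] ∧ t ∈ preimageTree φ p := by
  rw [wellFounded_iff_isEmpty_descending_chain]
  refine ⟨fun ⟨c, hc⟩ => hp ?_⟩
  have hlen : ∀ n, n ≤ (c n).length := by
    intro n
    induction n with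
    | zero => exact Nat.zero_le _
    | succ n ih =>
      obtain ⟨m, hm, -⟩ := hc n
      simpa [hm] using ih
  obtain ⟨w, hw⟩ := exists_limit_of_chain c
    (fun n => by
      obtain ⟨m, hm, -⟩ := hc n
      rw [hm]
      exact List.prefix_append _ _)
    (fun N => ⟨N + 1, hlen (N + 1)⟩)
  refine ⟨w, eq_of_forall_mem_preimageTree hφ fun n => ?_⟩
  obtain ⟨m, -, hm⟩ := hc n
  have hle : n ≤ (c (n + 1)).length := (Nat.le_succ n).trans (hlen (n + 1))
  refine preimageTree_of_append (t := (c (n + 1)).drop n) ?_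
  rwa [← take_initSeg w hle, hw, List.take_append_drop]

/-- A coanalytic set consists of the points `p` whose tree `preimageTree φ p` is well-founded, that
is, carries a strictly decreasing map to `ω₁`; and being such a map is a closed condition. -/
lemma exists_isClosed_of_analyticSet_compl {W : Type} [LinearOrder W] [WellFoundedLT W]
    [TopologicalSpace W] [DiscreteTopology W]
    (hW : ∀ S : Set W, S.Countable → ∃ b, ∀ a ∈ S, a < b)
    {C : Set ((ℕ → ℕ) × (ℕ → ℕ))} (hC : AnalyticSet Cᶜ) :
    ∃ D : Set (((ℕ → ℕ) × (ℕ → ℕ)) × (List ℕ → W)), IsClosed D ∧ C = Prod.fst '' D := by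
  obtain ⟨b, -⟩ := hW ∅ Set.countable_empty
  rw [AnalyticSet] at hC
  rcases hC with hC | ⟨φ, hφ, hr⟩
  · refine ⟨Set.univ, isClosed_univ, ?_⟩
    rw [Set.compl_empty_iff.1 hC]
    symm
    exact Set.eq_univ_of_forall fun p => ⟨(p, fun _ => b), trivial, rfl⟩
  refine ⟨{q | ∀ s m, s ++ [m] ∈ preimageTree φ q.1 → q.2 (s ++ [m]) < q.2 s}, ?_, ?_⟩
  · simp only [Set.ofPred_forall]
    refine isClosed_iInter fun s => isClosed_iInter fun m => ?_
    refine isClosed_imp ((isClopen_preimageTree φ _).isOpen.preimage continuous_fst) ?_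
    exact (isClosed_discrete {a : W × W | a.1 < a.2}).preimage (f := fun q :
      ((ℕ → ℕ) × (ℕ → ℕ)) × (List ℕ → W) => (q.2 (s ++ [m]), q.2 s)) (by fun_prop)
  · ext p
    have hpC : p ∈ C ↔ p ∉ Set.range φ := by rw [hr, Set.notMem_compl_iff]
    rw [hpC]
    constructor
    · intro hp
      have hwf := wellFounded_preimageTree hφ hp
      have hex : ∀ a : ℕ → W, ∃ b, ∀ m, a m < b := fun a =>
        (hW (Set.range a) (Set.countable_range a)).imp fun b h m => h (a m) (Set.mem_range_self m)
      classical
      choose bound hbound using hex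
      let g : List ℕ → W := hwf.fix fun s ih => bound fun m =>
        if h : s ++ [m] ∈ preimageTree φ p then ih (s ++ [m]) (by exact ⟨m, rfl, h⟩) else b
      refine ⟨(p, g), fun s m h => ?_, rfl⟩
      have hg : g s = bound fun m => if s ++ [m] ∈ preimageTree φ p then g (s ++ [m]) else b := by
        simp only [g]
        rw [WellFounded.fix_eq]
        rfl
      have := hbound (fun m => if s ++ [m] ∈ preimageTree φ p then g (s ++ [m]) else b) m
      rw [← hg, if_pos h] at this
      exact this
    · rintro ⟨⟨_, g⟩, hg, rfl⟩ ⟨w, hw⟩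
      refine (wellFounded_iff_isEmpty_descending_chain.1 (wellFounded_lt (α := W))).false
        ⟨fun n => g (initSeg w n), fun n => ?_⟩
      have := hg (initSeg w n) (w n)
      rw [← initSeg_succ] at this
      exact this ⟨w, by simp, by simp [hw], by simp [hw]⟩

lemma IsSigma12.isSuslin {W : Type} [LinearOrder W] [WellFoundedLT W]
    [TopologicalSpace W] [DiscreteTopology W]
    (hW : ∀ S : Set W, S.Countable → ∃ b, ∀ a ∈ S, a < b)
    {A : Set (ℕ → ℕ)} (hA : IsSigma12 A) : IsSuslin (ℕ × W) A := by
  obtain ⟨C, hC, rfl⟩ := hA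
  obtain ⟨D, hD, rfl⟩ := exists_isClosed_of_analyticSet_compl hW hC
  refine ⟨(fun p : (ℕ → ℕ) × (ℕ → ℕ × W) => ((p.1, fun n => (p.2 n).1),
    fun s : List ℕ => (p.2 (Encodable.encode s)).2)) ⁻¹' D, hD.preimage (by fun_prop), ?_⟩
  ext x
  constructor
  · rintro ⟨_, ⟨⟨⟨x, z⟩, g⟩, hg, rfl⟩, rfl⟩
    exact ⟨(x, fun n => (z n, g (Denumerable.ofNat (List ℕ) n))), by simpa using hg, rfl⟩
  · rintro ⟨⟨x, y⟩, hy, rfl⟩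
    exact ⟨_, ⟨_, hy, rfl⟩, rfl⟩

/-! ### The dichotomy under Martin's Axiom -/

theorem mainTheorem5 (hMA : MartinsAxiom) (hCH : ¬ ContinuumHypothesis) :
    (∀ A : Set (ℕ → ℕ), IsSigma12 A → HechlerLaverDichotomy A) ∧
      (∀ A : Set (ℕ → ℕ), IsUnionOfAlephOneBorel A → HechlerLaverDichotomy A) := by
  have hlt : ℵ₁ < (𝔠 : Cardinal.{0}) :=
    lt_of_le_of_ne aleph_one_le_continuum fun h => hCH h.symm
  constructor
  · intro A hA
    obtain ⟨W, _, _, hWcard, hW⟩ := exists_wellOrder_omega_one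
    let _ : TopologicalSpace W := ⊥
    have : DiscreteTopology W := ⟨rfl⟩
    refine (hA.isSuslin hW).hechlerLaverDichotomy (hMA.smallerThanBounding ?_)
    rw [mk_prod, hWcard]
    simpa using mul_lt_of_lt aleph0_le_continuum aleph0_lt_continuum hlt
  · rintro A ⟨ι, B, hι, hB, rfl⟩
    let _ : TopologicalSpace ι := ⊥
    have : DiscreteTopology ι := ⟨rfl⟩
    have hB' : ∀ i, AnalyticSet (B i) := fun i => by
      have h := hB i
      rw [← BorelSpace.measurable_eq] at h
      exact h.analyticSet
    refine (isSuslin_iUnion_of_analyticSet hB').hechlerLaverDichotomy (hMA.smallerThanBounding ?_)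
    rw [mk_prod, hι]
    simpa using mul_lt_of_lt aleph0_le_continuum hlt aleph0_lt_continuum
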